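/- Let $C_4$ be the cycle with four edges. A family $F$ of sets is a Berge-$C_4$ if it consists of exactly four distinct sets which can be named $A,B,C,D$ so that there are four distinct elements $x_1\in A\cap B$, $x_2\in B\cap C$, $x_3\in C\cap D$, $x_4\in D\cap A$. For $n\ge 1$ let $f(n,C_4)$ be the smallest number of colors in a coloring of all subsets of $[n]=\{1,\dots,n\}$ such that no color class contains a Berge-$C_4$. Then the following hold. (1) For even $n$, $f(n,C_4)=\frac{2^{n-1}}{3}\left(1+\Theta\left(\frac{1}{\sqrt n}\right)\right)$; that is, there are constants $c,C>0$ such that for every even $n\ge 26$, $$\frac{2^{n-1}}{3}\left(1+\frac{c}{\sqrt n}\right)\le f(n,C_4)\le \frac{2^{n-1}}{3}\left(1+\frac{C}{\sqrt n}\right).$$ (2) For all $n\ge 27$, $\frac{2^{n-1}}{3}\le f(n,C_4)\le\frac{2^{n-1}}{3}\left(1+O\left(\frac{1}{\sqrt n}\right)\right)$; that is, there is a constant $C>0$ such that for every $n\ge 27$, $$\frac{2^{n-1}}{3}\le f(n,C_4)\le \frac{2^{n-1}}{3}\left(1+\frac{C}{\sqrt n}\right).$$ -/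

import Mathlib

/-- A family `F` of finite sets of vertices (the edges of a hypergraph on `α`) is a *Berge-`G`*
hypergraph: after placing the vertices of `G` injectively into `α`, there is a bijection `g` from
the edges of `G` to the members of `F` such that `e ⊆ g e` for every edge `e` of `G`. -/
def IsBerge {W α : Type*} (G : SimpleGraph W) (F : Set (Finset α)) : Prop :=
  ∃ (φ : W ↪ α) (g : G.edgeSet ≃ F), ∀ (e : G.edgeSet) (v : W), v ∈ (e : Sym2 W) →
    φ v ∈ (g e : Finset α)

/-- A family `H` of sets is *`G`-free* if no subfamily of `H` is a Berge-`G` hypergraph. -/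
def BergeFree {W α : Type*} (G : SimpleGraph W) (H : Set (Finset α)) : Prop :=
  ∀ F : Set (Finset α), F ⊆ H → ¬ IsBerge G F

/-- A colouring of all subsets of an `n`-element set with `t` colours, every colour class of which
is `G`-free. -/
def IsBergeFreeColoring {W : Type*} (G : SimpleGraph W) (n t : ℕ)
    (c : Finset (Fin n) → Fin t) : Prop :=
  ∀ i : Fin t, BergeFree G {A : Finset (Fin n) | c A = i}

/-- `f(n, G)`: the smallest number of colours in a colouring of all subsets of an `n`-element set
such that every colour class is `G`-free. -/
noncomputable def bergeColorNumber {W : Type*} (n : ℕ) (G : SimpleGraph W) : ℕ :=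
  sInf {t : ℕ | ∃ c : Finset (Fin n) → Fin t, IsBergeFreeColoring G n t c}

/-! Lower bound: give a set weight 3, 2 or 0 according as its size is above, equal to or below n/2.
A set and its complement weigh 3 together, or 4 in the middle level, so twice the total is 3·2^n
plus the size of that level. A C₄-free class weighs at most 9 (`BergeFree.sum_halfWeight_le`). Three
sets never exceed this. Four sets of size at least n/2 avoid a Berge-C₄ only if one of them nearly
misses the other three, which forces three of the four to have size exactly n/2. Five such sets are
impossible.

Upper bound: let m = ⌈n/2⌉. Hall's theorem gives an injection f that removes one point from each set
above level m. Sets of size at least m are coloured by descending along f to a level congruent to m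
mod 3. Small sets are coloured through their complements, descending at least two steps. A class
then has at most three large and three small sets, every small one disjoint from every large one, so
no four of them are cyclically linked (`not_cyclic_of_tripleColor_eq`). The colours number one third
of the upper half plus O(C(n, n/2)), and C(n, n/2) has order 2^n/√n. -/

/-! ### Berge four-cycles as cyclic sequences of sets -/

/-- The sets `A`, `B`, `C`, `D`, in this cyclic order, admit distinct representatives of the
consecutive intersections. -/
def HasCyclicReps {α : Type*} (A B C D : Finset α) : Prop :=
  ∃ x₁ x₂ x₃ x₄ : α, x₁ ≠ x₂ ∧ x₁ ≠ x₃ ∧ x₁ ≠ x₄ ∧ x₂ ≠ x₃ ∧ x₂ ≠ x₄ ∧ x₃ ≠ x₄ ∧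
    (x₁ ∈ A ∧ x₁ ∈ B) ∧ (x₂ ∈ B ∧ x₂ ∈ C) ∧ (x₃ ∈ C ∧ x₃ ∈ D) ∧ (x₄ ∈ D ∧ x₄ ∈ A)

/-- The edges of the four-cycle, indexed by their first vertex. -/
noncomputable def cycleFourEdge : Fin 4 ≃ (SimpleGraph.cycleGraph 4).edgeSet :=
  Equiv.ofBijective
    (fun i => ⟨s(i, i + 1), by
      rw [SimpleGraph.mem_edgeSet, SimpleGraph.cycleGraph_adj]; revert i; decide⟩)
    ⟨by
      intro i j h
      have h' := Subtype.ext_iff.1 h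
      revert i j; decide, by
      rintro ⟨e, he⟩
      induction e using Sym2.ind with
      | _ a b =>
        rw [SimpleGraph.mem_edgeSet, SimpleGraph.cycleGraph_adj] at he
        simp only [Subtype.mk.injEq]
        revert a b; decide⟩

theorem coe_cycleFourEdge (i : Fin 4) : (cycleFourEdge i : Sym2 (Fin 4)) = s(i, i + 1) := rfl

theorem BergeFree.not_hasCyclicReps {α : Type*} {H : Set (Finset α)}
    (hH : BergeFree (SimpleGraph.cycleGraph 4) H) {A B C D : Finset α}
    (hA : A ∈ H) (hB : B ∈ H) (hC : C ∈ H) (hD : D ∈ H)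
    (hAB : A ≠ B) (hAC : A ≠ C) (hAD : A ≠ D) (hBC : B ≠ C) (hBD : B ≠ D) (hCD : C ≠ D) :
    ¬ HasCyclicReps A B C D := by
  rintro ⟨x₁, x₂, x₃, x₄, h12, h13, h14, h23, h24, h34, h1, h2, h3, h4⟩
  have hinj : Function.Injective ![A, B, C, D] := by
    intro i j
    fin_cases i <;> fin_cases j <;> simp [*, Ne.symm]
  -- Edge i joins vertices i and i + 1, so the list starts at x₄: then A, as edge 0, carries x₄ and
  -- x₁.
  have hφ : Function.Injective ![x₄, x₁, x₂, x₃] := by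
    intro i j
    fin_cases i <;> fin_cases j <;> simp [*, Ne.symm]
  refine hH (Set.range ![A, B, C, D]) ?_ ⟨⟨_, hφ⟩,
    cycleFourEdge.symm.trans (Equiv.ofInjective _ hinj), ?_⟩
  · rintro _ ⟨i, rfl⟩
    fin_cases i <;> simpa
  · intro e v hv
    obtain ⟨i, rfl⟩ := cycleFourEdge.surjective e
    rw [coe_cycleFourEdge, Sym2.mem_iff] at hv
    simp only [Equiv.trans_apply, Equiv.symm_apply_apply, Equiv.ofInjective_apply]
    rcases hv with rfl | rfl
    · fin_cases v <;> simp [*]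
    · fin_cases i <;> simp [*]

/-- Distinctness of the representatives is dropped: the colouring excludes even this weaker
configuration. -/
theorem IsBerge.exists_cyclic {α : Type*} {F : Set (Finset α)}
    (hF : IsBerge (SimpleGraph.cycleGraph 4) F) :
    ∃ g : Fin 4 → Finset α, Function.Injective g ∧ (∀ i, g i ∈ F) ∧
      ∀ i, ∃ x, x ∈ g i ∧ x ∈ g (i + 1) := by
  obtain ⟨φ, g, h⟩ := hF
  refine ⟨fun i => g (cycleFourEdge i), fun i j hij =>
    cycleFourEdge.injective (g.injective (Subtype.ext hij)), fun i => (g _).2, fun i =>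
    ⟨φ (i + 1), h _ _ ?_, h _ _ ?_⟩⟩
  · rw [coe_cycleFourEdge]; simp
  · rw [coe_cycleFourEdge]; simp

theorem BergeFree.mono {W α : Type*} {G : SimpleGraph W} {H H' : Set (Finset α)}
    (hH : BergeFree G H) (h : H' ⊆ H) : BergeFree G H' :=
  fun F hF => hH F (hF.trans h)

/-! ### Lower bound: large sets in a C₄-free class -/

/-- The weight of a set in the count of large sets, three times its share of a colour. -/
def halfWeight {α : Type*} [Fintype α] (A : Finset α) : ℕ :=
  if Fintype.card α < 2 * A.card then 3 else if Fintype.card α = 2 * A.card then 2 else 0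

theorem halfWeight_le {α : Type*} [Fintype α] (A : Finset α) : halfWeight A ≤ 3 := by
  unfold halfWeight; split_ifs <;> omega

section LargeSets

variable {α : Type*} [DecidableEq α]

theorem Finset.exists_mem_ne_ne_ne {s : Finset α} (hs : 4 ≤ s.card) (a b c : α) :
    ∃ x ∈ s, x ≠ a ∧ x ≠ b ∧ x ≠ c := by
  have h3 : ({a, b, c} : Finset α).card ≤ 3 := Finset.card_le_three
  obtain ⟨x, hx, hx'⟩ := Finset.exists_mem_notMem_of_card_lt_card (h3.trans_lt hs)
  simp only [Finset.mem_insert, Finset.mem_singleton, not_or] at hx'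
  exact ⟨x, hx, hx'⟩

/-- Two representatives are given; the other two are chosen greedily, since an intersection of four
points survives the exclusion of three. -/
theorem HasCyclicReps.of_opposite {A B C D : Finset α} {x y : α} (hxy : x ≠ y)
    (hxA : x ∈ A) (hxB : x ∈ B) (hyC : y ∈ C) (hyD : y ∈ D)
    (hBC : 4 ≤ (B ∩ C).card) (hAD : 4 ≤ (A ∩ D).card) : HasCyclicReps A B C D := by
  obtain ⟨z, hz, hzx, hzy, -⟩ := Finset.exists_mem_ne_ne_ne hBC x y y
  obtain ⟨w, hw, hwx, hwy, hwz⟩ := Finset.exists_mem_ne_ne_ne hAD x y z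
  rw [Finset.mem_inter] at hz hw
  exact ⟨x, z, y, w, hzx.symm, hxy, hwx.symm, hzy, hwz.symm, hwy.symm, ⟨hxA, hxB⟩, hz,
    ⟨hyC, hyD⟩, hw.2, hw.1⟩

theorem HasCyclicReps.of_adjacent {A B C D : Finset α} {x y : α} (hxy : x ≠ y)
    (hxA : x ∈ A) (hxB : x ∈ B) (hyA : y ∈ A) (hyD : y ∈ D)
    (hBC : 4 ≤ (B ∩ C).card) (hCD : 4 ≤ (C ∩ D).card) : HasCyclicReps A B C D := by
  obtain ⟨z, hz, hzx, hzy, -⟩ := Finset.exists_mem_ne_ne_ne hBC x y y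
  obtain ⟨w, hw, hwx, hwy, hwz⟩ := Finset.exists_mem_ne_ne_ne hCD x y z
  rw [Finset.mem_inter] at hz hw
  exact ⟨x, z, w, y, hzx.symm, hwx.symm, hxy, hwz.symm, hzy, hwy, ⟨hxA, hxB⟩, hz,
    hw, hyD, hyA⟩

theorem Finset.card_lt_card_union_of_ne {A B : Finset α} (h : A ≠ B) :
    A.card < (A ∪ B).card ∨ B.card < (A ∪ B).card := by
  by_contra! hc
  have h1 := Finset.eq_of_subset_of_card_le Finset.subset_union_left hc.1
  have h2 := Finset.eq_of_subset_of_card_le Finset.subset_union_right hc.2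
  exact h (h1.trans h2.symm)

variable [Fintype α]

theorem Finset.card_add_card_le_of_inter {A B : Finset α} {k : ℕ} (h : (A ∩ B).card ≤ k) :
    A.card + B.card ≤ Fintype.card α + k := by
  have h1 := Finset.card_union_add_card_inter A B
  have h2 := Finset.card_le_univ (A ∪ B)
  omega

theorem Finset.card_three_le (A B C : Finset α) :
    A.card + B.card + C.card ≤
      Fintype.card α + (A ∩ B).card + (A ∩ C).card + (B ∩ C).card := by
  have h1 := Finset.card_union_add_card_inter A B
  have h2 := Finset.card_union_add_card_inter (A ∪ B) C
  have h3 := Finset.card_le_univ (A ∪ B ∪ C)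
  have h4 : ((A ∪ B) ∩ C).card ≤ (A ∩ C).card + (B ∩ C).card := by
    rw [Finset.union_inter_distrib_right]
    exact Finset.card_union_le _ _
  omega

/-- Two distinct sets, each of size at least half, cannot both be disjoint from a third one. -/
theorem exists_mem_or_of_half_le {A B C : Finset α} (hBC : B ≠ C)
    (hA : Fintype.card α ≤ 2 * A.card) (hB : Fintype.card α ≤ 2 * B.card)
    (hC : Fintype.card α ≤ 2 * C.card) : ∃ x ∈ A, x ∈ B ∨ x ∈ C := by
  by_contra! h
  have h0 : (A ∩ (B ∪ C)).card ≤ 0 := by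
    rw [Nat.le_zero, Finset.card_eq_zero, Finset.eq_empty_iff_forall_notMem]
    intro x hx
    simp only [Finset.mem_inter, Finset.mem_union] at hx
    have := h x hx.1
    tauto
  have h1 := Finset.card_add_card_le_of_inter h0
  have h2 := Finset.card_lt_card_union_of_ne hBC
  omega

/-- Two pairs of half-size sets with large intersections are joined to a cycle. -/
theorem hasCyclicReps_or_of_four_le {A B C D : Finset α} (hAD : A ≠ D) (hBC : B ≠ C)
    (hA : Fintype.card α ≤ 2 * A.card) (hB : Fintype.card α ≤ 2 * B.card)
    (hC : Fintype.card α ≤ 2 * C.card) (hD : Fintype.card α ≤ 2 * D.card)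
    (h1 : 4 ≤ (A ∩ D).card) (h2 : 4 ≤ (B ∩ C).card) :
    HasCyclicReps A B C D ∨ HasCyclicReps A C B D := by
  by_contra! hn
  have key1 : ∀ x y, x ∈ A → x ∈ B → y ∈ C → y ∈ D → x = y := by
    intro x y ha hb hc hd
    by_contra hxy
    exact hn.1 (.of_opposite hxy ha hb hc hd h2 h1)
  have key2 : ∀ x y, x ∈ A → x ∈ C → y ∈ B → y ∈ D → x = y := by
    intro x y ha hb hc hd
    by_contra hxy
    exact hn.2 (.of_opposite hxy ha hb hc hd (by rwa [Finset.inter_comm]) h1)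
  have eA := exists_mem_or_of_half_le (A := A) hBC hA hB hC
  have eB := exists_mem_or_of_half_le (A := B) hAD hB hA hD
  have eC := exists_mem_or_of_half_le (A := C) hAD hC hA hD
  have eD := exists_mem_or_of_half_le (A := D) hBC hD hB hC
  -- One of the pairs A∩B, C∩D or A∩C, B∩D has both members nonempty, as otherwise some set would
  -- miss both sets of the other pair. Their common point lies in all four sets, and `key1`, `key2`
  -- collapse every crossing point to it.
  obtain ⟨x, hx⟩ : ∃ x, ∀ z, (z ∈ A ∨ z ∈ D) → (z ∈ B ∨ z ∈ C) → z = x := by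
    obtain ⟨a, ha, ha'⟩ := eA
    obtain ⟨b, hb, hb'⟩ := eB
    obtain ⟨c, hc, hc'⟩ := eC
    obtain ⟨d, hd, hd'⟩ := eD
    refine ⟨a, fun z hz hz' => ?_⟩
    grind
  have h3 : ((A ∪ D) ∩ (B ∪ C)).card ≤ 1 := by
    rw [Finset.card_le_one_iff]
    intro a b ha hb
    simp only [Finset.mem_inter, Finset.mem_union] at ha hb
    rw [hx a ha.1 ha.2, hx b hb.1 hb.2]
  have h4 := Finset.card_add_card_le_of_inter h3
  have h5 := Finset.card_lt_card_union_of_ne hBC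
  have h6 := Finset.card_lt_card_union_of_ne hAD
  omega

variable {H : Set (Finset α)}

/-- B, C, D nearly fill the complement of A, so they overlap heavily. Two distinct points joining A
to two of them would therefore close up through the third. -/
theorem BergeFree.star (hH : BergeFree (SimpleGraph.cycleGraph 4) H)
    (hn : 26 ≤ Fintype.card α) (hl : ∀ A ∈ H, Fintype.card α ≤ 2 * A.card)
    {A B C D : Finset α} (hA : A ∈ H) (hB : B ∈ H) (hC : C ∈ H) (hD : D ∈ H)
    (hAB : A ≠ B) (hAC : A ≠ C) (hAD : A ≠ D) (hBC : B ≠ C) (hBD : B ≠ D) (hCD : C ≠ D)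
    (h1 : (A ∩ B).card ≤ 3) (h2 : (A ∩ C).card ≤ 3) (h3 : (A ∩ D).card ≤ 3) :
    (A ∩ B).card ≤ 1 ∧ (A ∩ C).card ≤ 1 ∧ (A ∩ D).card ≤ 1 ∧
      halfWeight A + halfWeight B + halfWeight C + halfWeight D ≤ 9 := by
  have lA := hl A hA
  have lB := hl B hB
  have lC := hl C hC
  have lD := hl D hD
  have sBC : 4 ≤ (B ∩ C).card := by have := Finset.card_three_le A B C; omega
  have sBD : 4 ≤ (B ∩ D).card := by have := Finset.card_three_le A B D; omega
  have sCD : 4 ≤ (C ∩ D).card := by have := Finset.card_three_le A C D; omega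
  have kBC : ∀ x y, x ∈ A → y ∈ A → x ∈ B → y ∈ C → x = y := by
    intro x y hx hy hx' hy'
    by_contra hxy
    exact hH.not_hasCyclicReps hA hB hD hC hAB hAD hAC hBD hBC hCD.symm
      (.of_adjacent hxy hx hx' hy hy' sBD (by rwa [Finset.inter_comm]))
  have kBD : ∀ x y, x ∈ A → y ∈ A → x ∈ B → y ∈ D → x = y := by
    intro x y hx hy hx' hy'
    by_contra hxy
    exact hH.not_hasCyclicReps hA hB hC hD hAB hAC hAD hBC hBD hCD
      (.of_adjacent hxy hx hx' hy hy' sBC sCD)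
  have kCD : ∀ x y, x ∈ A → y ∈ A → x ∈ C → y ∈ D → x = y := by
    intro x y hx hy hx' hy'
    by_contra hxy
    exact hH.not_hasCyclicReps hA hC hB hD hAC hAB hAD hBC.symm hCD hBD
      (.of_adjacent hxy hx hx' hy hy' (by rwa [Finset.inter_comm]) sBD)
  have eBC := exists_mem_or_of_half_le (A := A) hBC lA lB lC
  have eBD := exists_mem_or_of_half_le (A := A) hBD lA lB lD
  have eCD := exists_mem_or_of_half_le (A := A) hCD lA lC lD
  have hW : (A ∩ (B ∪ C ∪ D)).card ≤ 1 := by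
    rw [Finset.card_le_one_iff]
    intro a b ha hb
    simp only [Finset.mem_inter, Finset.mem_union] at ha hb
    grind
  have hle : ∀ X ⊆ B ∪ C ∪ D, (A ∩ X).card ≤ 1 := fun X hX =>
    (Finset.card_le_card (Finset.inter_subset_inter_left hX)).trans hW
  have sB : B ⊆ B ∪ C ∪ D := fun x hx => by simp [hx]
  have sC : C ⊆ B ∪ C ∪ D := fun x hx => by simp [hx]
  have sD : D ⊆ B ∪ C ∪ D := fun x hx => by simp [hx]
  refine ⟨hle B sB, hle C sC, hle D sD, ?_⟩
  -- Since B ≠ C, |A| + |B ∪ C| ≤ n + 1 forces |A| and the smaller of |B|, |C| to equal n/2. Over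
  -- all pairs, at most one of B, C, D exceeds n/2, so the weight is at most 2 + 2 + 2 + 3.
  have uBC := Finset.card_add_card_le_of_inter (hle (B ∪ C) (Finset.union_subset sB sC))
  have uBD := Finset.card_add_card_le_of_inter (hle (B ∪ D) (Finset.union_subset sB sD))
  have uCD := Finset.card_add_card_le_of_inter (hle (C ∪ D) (Finset.union_subset sC sD))
  have vBC := Finset.card_lt_card_union_of_ne hBC
  have vBD := Finset.card_lt_card_union_of_ne hBD
  have vCD := Finset.card_lt_card_union_of_ne hCD
  unfold halfWeight
  split_ifs <;> omega

/-- `A` meets each of `B`, `C`, `D` in at most one element. -/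
def IsStarCenter (A B C D : Finset α) : Prop :=
  (A ∩ B).card ≤ 1 ∧ (A ∩ C).card ≤ 1 ∧ (A ∩ D).card ≤ 1

/-- Each of the three splittings of the four sets into two pairs contains a pair with small
intersection. Three such pairs form a star or a triangle, and a triangle contradicts
`Finset.card_three_le`. -/
theorem BergeFree.exists_star (hH : BergeFree (SimpleGraph.cycleGraph 4) H)
    (hn : 26 ≤ Fintype.card α) (hl : ∀ A ∈ H, Fintype.card α ≤ 2 * A.card)
    {A B C D : Finset α} (hA : A ∈ H) (hB : B ∈ H) (hC : C ∈ H) (hD : D ∈ H)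
    (hAB : A ≠ B) (hAC : A ≠ C) (hAD : A ≠ D) (hBC : B ≠ C) (hBD : B ≠ D) (hCD : C ≠ D) :
    (IsStarCenter A B C D ∨ IsStarCenter B A C D ∨ IsStarCenter C A B D ∨
      IsStarCenter D A B C) ∧
      halfWeight A + halfWeight B + halfWeight C + halfWeight D ≤ 9 := by
  have lA := hl A hA
  have lB := hl B hB
  have lC := hl C hC
  have lD := hl D hD
  have m1 : (A ∩ D).card ≤ 3 ∨ (B ∩ C).card ≤ 3 := by
    by_contra! h
    rcases hasCyclicReps_or_of_four_le hAD hBC lA lB lC lD h.1 h.2 with h | h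
    · exact hH.not_hasCyclicReps hA hB hC hD hAB hAC hAD hBC hBD hCD h
    · exact hH.not_hasCyclicReps hA hC hB hD hAC hAB hAD hBC.symm hCD hBD h
  have m2 : (A ∩ C).card ≤ 3 ∨ (B ∩ D).card ≤ 3 := by
    by_contra! h
    rcases hasCyclicReps_or_of_four_le hAC hBD lA lB lD lC h.1 h.2 with h | h
    · exact hH.not_hasCyclicReps hA hB hD hC hAB hAD hAC hBD hBC hCD.symm h
    · exact hH.not_hasCyclicReps hA hD hB hC hAD hAB hAC hBD.symm hCD.symm hBC h
  have m3 : (A ∩ B).card ≤ 3 ∨ (C ∩ D).card ≤ 3 := by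
    by_contra! h
    rcases hasCyclicReps_or_of_four_le hAB hCD lA lC lD lB h.1 h.2 with h | h
    · exact hH.not_hasCyclicReps hA hC hD hB hAC hAD hAB hCD hBC.symm hBD.symm h
    · exact hH.not_hasCyclicReps hA hD hC hB hAD hAC hAB hCD.symm hBD.symm hBC.symm h
  have tABC := Finset.card_three_le A B C
  have tABD := Finset.card_three_le A B D
  have tACD := Finset.card_three_le A C D
  have tBCD := Finset.card_three_le B C D
  have cBA := Finset.inter_comm B A
  have cCA := Finset.inter_comm C A
  have cDA := Finset.inter_comm D A
  have cCB := Finset.inter_comm C B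
  have cDB := Finset.inter_comm D B
  have cDC := Finset.inter_comm D C
  rcases m1 with m1 | m1 <;> rcases m2 with m2 | m2 <;> rcases m3 with m3 | m3 <;> try omega
  · have := hH.star hn hl hA hB hC hD hAB hAC hAD hBC hBD hCD m3 m2 m1
    exact ⟨.inl ⟨this.1, this.2.1, this.2.2.1⟩, this.2.2.2⟩
  · have := hH.star hn hl hD hA hB hC hAD.symm hBD.symm hCD.symm hAB hAC hBC
      (by rwa [cDA]) (by rwa [cDB]) (by rwa [cDC])
    exact ⟨.inr (.inr (.inr ⟨this.1, this.2.1, this.2.2.1⟩)), by omega⟩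
  · have := hH.star hn hl hC hA hB hD hAC.symm hBC.symm hCD hAB hAD hBD
      (by rwa [cCA]) (by rwa [cCB]) m3
    exact ⟨.inr (.inr (.inl ⟨this.1, this.2.1, this.2.2.1⟩)), by omega⟩
  · have := hH.star hn hl hB hA hC hD hAB.symm hBC hBD hAC hAD hCD
      (by rwa [cBA]) m1 m2
    exact ⟨.inr (.inl ⟨this.1, this.2.1, this.2.2.1⟩), by omega⟩

theorem BergeFree.card_le_four (hH : BergeFree (SimpleGraph.cycleGraph 4) H)
    (hn : 26 ≤ Fintype.card α) (hl : ∀ A ∈ H, Fintype.card α ≤ 2 * A.card)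
    {s : Finset (Finset α)} (hs : ∀ A ∈ s, A ∈ H) : s.card ≤ 4 := by
  by_contra! h5
  obtain ⟨t, hts, ht⟩ := Finset.exists_subset_card_eq (show 5 ≤ s.card from h5)
  let e := (Finset.equivFinOfCardEq ht).symm
  have hm : ∀ i, (e i : Finset α) ∈ H := fun i => hs _ (hts (e i).2)
  have hne : ∀ i j, i ≠ j → (e i : Finset α) ≠ e j := fun i j hij h =>
    hij (e.injective (Subtype.ext h))
  let w : Fin 5 → Fin 5 → Prop := fun i j => ((e i : Finset α) ∩ e j).card ≤ 1
  have hsymm : ∀ i j, w i j → w j i := fun i j h => by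
    simpa only [w, Finset.inter_comm] using h
  have htri : ∀ i j k, ¬ (w i j ∧ w i k ∧ w j k) := by
    rintro i j k ⟨h1, h2, h3⟩
    have := Finset.card_three_le (e i : Finset α) (e j) (e k)
    have l1 := hl _ (hm i)
    have l2 := hl _ (hm j)
    have l3 := hl _ (hm k)
    simp only [w] at h1 h2 h3
    omega
  have hstar : ∀ i j k l, i ≠ j → i ≠ k → i ≠ l → j ≠ k → j ≠ l → k ≠ l →
      (w i j ∧ w i k ∧ w i l) ∨ (w j i ∧ w j k ∧ w j l) ∨ (w k i ∧ w k j ∧ w k l) ∨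
        (w l i ∧ w l j ∧ w l k) := fun i j k l h1 h2 h3 h4 h5 h6 =>
    (hH.exists_star hn hl (hm i) (hm j) (hm k) (hm l) (hne _ _ h1) (hne _ _ h2) (hne _ _ h3)
      (hne _ _ h4) (hne _ _ h5) (hne _ _ h6)).1
  -- In the triangle-free graph `w`, a star at i makes j, k, l independent, so m is the centre of
  -- {j, k, l, m}. The star on {i, j, k, m} then needs the edge im, giving the triangle i, j, m.
  have key : ∀ i j k l m, i ≠ j → i ≠ k → i ≠ l → i ≠ m → j ≠ k → j ≠ l → j ≠ m → k ≠ l →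
      k ≠ m → l ≠ m → ¬ (w i j ∧ w i k ∧ w i l) := by
    intro i j k l m h1 h2 h3 h4 h5 h6 h7 h8 h9 h10 ⟨a1, a2, a3⟩
    have n1 : ¬ w j k := fun h => htri i j k ⟨a1, a2, h⟩
    have n2 : ¬ w j l := fun h => htri i j l ⟨a1, a3, h⟩
    have n3 : ¬ w k l := fun h => htri i k l ⟨a2, a3, h⟩
    have b := hstar j k l m h5 h6 h7 h8 h9 h10
    have c := hstar i j k m h1 h2 h4 h5 h7 h9
    rcases b with h | h | h | h
    · exact n1 h.1
    · exact n1 (hsymm _ _ h.1)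
    · exact n2 (hsymm _ _ h.1)
    · rcases c with h' | h' | h' | h'
      · exact htri i j m ⟨a1, h'.2.2, hsymm _ _ h.1⟩
      · exact n1 h'.2.1
      · exact n1 (hsymm _ _ h'.2.1)
      · exact htri i j m ⟨a1, hsymm _ _ h'.1, hsymm _ _ h.1⟩
  clear_value w
  rcases hstar 0 1 2 3 (by decide) (by decide) (by decide) (by decide) (by decide) (by decide)
    with h | h | h | h
  · exact key 0 1 2 3 4 (by decide) (by decide) (by decide) (by decide) (by decide) (by decide)
      (by decide) (by decide) (by decide) (by decide) h
  · exact key 1 0 2 3 4 (by decide) (by decide) (by decide) (by decide) (by decide) (by decide)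
      (by decide) (by decide) (by decide) (by decide) h
  · exact key 2 0 1 3 4 (by decide) (by decide) (by decide) (by decide) (by decide) (by decide)
      (by decide) (by decide) (by decide) (by decide) h
  · exact key 3 0 1 2 4 (by decide) (by decide) (by decide) (by decide) (by decide) (by decide)
      (by decide) (by decide) (by decide) (by decide) h

theorem BergeFree.sum_halfWeight_le {s : Finset (Finset α)}
    (hs : BergeFree (SimpleGraph.cycleGraph 4) (s : Set (Finset α)))
    (hn : 26 ≤ Fintype.card α) : ∑ A ∈ s, halfWeight A ≤ 9 := by
  set t := s.filter fun A => Fintype.card α ≤ 2 * A.card with ht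
  have hst : ∑ A ∈ t, halfWeight A = ∑ A ∈ s, halfWeight A := by
    refine Finset.sum_subset (Finset.filter_subset _ _) fun A hA hA' => ?_
    have : ¬ Fintype.card α ≤ 2 * A.card := fun h => hA' (Finset.mem_filter.2 ⟨hA, h⟩)
    unfold halfWeight
    rw [if_neg (by omega), if_neg (by omega)]
  rw [← hst]
  have hfree : BergeFree (SimpleGraph.cycleGraph 4) (t : Set (Finset α)) :=
    hs.mono (by exact_mod_cast Finset.filter_subset _ _)
  have hl : ∀ A ∈ (t : Set (Finset α)), Fintype.card α ≤ 2 * A.card := fun A hA =>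
    (Finset.mem_filter.1 (Finset.mem_coe.1 hA)).2
  have h4 : t.card ≤ 4 := hfree.card_le_four hn hl fun A hA => Finset.mem_coe.2 hA
  rcases h4.lt_or_eq with h | h
  · calc ∑ A ∈ t, halfWeight A ≤ ∑ _A ∈ t, 3 := Finset.sum_le_sum fun A _ => halfWeight_le A
      _ ≤ 9 := by rw [Finset.sum_const, smul_eq_mul]; omega
  · obtain ⟨A, B, C, D, hAB, hAC, hAD, hBC, hBD, hCD, hT⟩ := Finset.card_eq_four.1 h
    have hmem : ∀ X, X ∈ t ↔ X = A ∨ X = B ∨ X = C ∨ X = D := fun X => by rw [hT]; simp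
    have := (hfree.exists_star hn hl (A := A) (B := B) (C := C) (D := D) (by simp [hmem])
      (by simp [hmem]) (by simp [hmem]) (by simp [hmem]) hAB hAC hAD hBC hBD hCD).2
    rw [hT, Finset.sum_insert (by simp [*]), Finset.sum_insert (by simp [*]),
      Finset.sum_insert (by simp [*]), Finset.sum_singleton]
    omega

theorem two_mul_sum_halfWeight :
    2 * ∑ A : Finset α, halfWeight A = 3 * 2 ^ Fintype.card α +
      (Finset.univ.filter fun A : Finset α => 2 * A.card = Fintype.card α).card := by
  have h1 : ∑ A : Finset α, halfWeight A = ∑ A : Finset α, halfWeight Aᶜ :=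
    (Fintype.sum_equiv (compl_involutive (α := Finset α)).toPerm _ _ fun A => by
      simp [Function.Involutive.toPerm])
  have h2 : ∀ A : Finset α, halfWeight A + halfWeight Aᶜ =
      3 + if 2 * A.card = Fintype.card α then 1 else 0 := by
    intro A
    have := Finset.card_add_card_compl A
    unfold halfWeight
    split_ifs <;> omega
  rw [two_mul]
  nth_rewrite 2 [h1]
  rw [← Finset.sum_add_distrib, Finset.sum_congr rfl fun A _ => h2 A, Finset.sum_add_distrib]
  simp [mul_comm]

end LargeSets

/-! ### Central binomial coefficients are of order 2^n/√n -/

section Binomial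

theorem Nat.centralBinom_sq_mul_le (k : ℕ) : k.centralBinom ^ 2 * (2 * k + 1) ≤ 16 ^ k := by
  induction k with
  | zero => simp
  | succ k ih =>
    have h := Nat.succ_mul_centralBinom_succ k
    have hpos : 0 < (k + 1) ^ 2 := by positivity
    refine Nat.le_of_mul_le_mul_left ?_ hpos
    calc (k + 1) ^ 2 * ((k + 1).centralBinom ^ 2 * (2 * (k + 1) + 1))
        = ((k + 1) * (k + 1).centralBinom) ^ 2 * (2 * k + 3) := by ring
      _ = (k.centralBinom ^ 2 * (2 * k + 1)) * (4 * (2 * k + 1) * (2 * k + 3)) := by rw [h]; ring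
      _ ≤ 16 ^ k * (16 * (k + 1) ^ 2) := Nat.mul_le_mul ih (by nlinarith)
      _ = (k + 1) ^ 2 * 16 ^ (k + 1) := by ring

theorem Nat.le_centralBinom_sq_mul {k : ℕ} (hk : 1 ≤ k) :
    16 ^ k ≤ k.centralBinom ^ 2 * (4 * k) := by
  induction k, hk using Nat.le_induction with
  | base => decide
  | succ k hk ih =>
    have h := Nat.succ_mul_centralBinom_succ k
    have hpos : 0 < k * (k + 1) := by positivity
    refine Nat.le_of_mul_le_mul_left ?_ hpos
    calc k * (k + 1) * 16 ^ (k + 1) = 16 ^ k * (16 * (k * (k + 1))) := by ring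
      _ ≤ (k.centralBinom ^ 2 * (4 * k)) * (4 * (2 * k + 1) ^ 2) :=
        Nat.mul_le_mul ih (by nlinarith)
      _ = k * (4 * (2 * (2 * k + 1) * k.centralBinom) ^ 2) := by ring
      _ = k * (4 * ((k + 1) * (k + 1).centralBinom) ^ 2) := by rw [h]
      _ = k * (k + 1) * ((k + 1).centralBinom ^ 2 * (4 * (k + 1))) := by ring

theorem Nat.choose_half_sq_mul_le (n : ℕ) : n.choose (n / 2) ^ 2 * n ≤ 4 ^ n := by
  rcases Nat.even_or_odd' n with ⟨k, rfl | rfl⟩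
  · rw [Nat.mul_div_cancel_left _ two_pos, ← Nat.centralBinom_eq_two_mul_choose, pow_mul]
    exact (Nat.mul_le_mul_left _ (by omega)).trans (Nat.centralBinom_sq_mul_le k)
  · have h1 : (2 * k + 1) / 2 = k := by omega
    have h2 : (k + 1).centralBinom = 2 * (2 * k + 1).choose k := by
      rw [Nat.centralBinom_eq_two_mul_choose, show 2 * (k + 1) = 2 * k + 1 + 1 by ring,
        Nat.choose_succ_succ, Nat.choose_symm_half]
      ring
    have h3 := Nat.centralBinom_sq_mul_le (k + 1)
    rw [h2] at h3
    rw [h1]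
    have h4 : (16 : ℕ) ^ (k + 1) = 4 * 4 ^ (2 * k + 1) := by
      rw [show (16 : ℕ) = 4 ^ 2 by norm_num, ← pow_mul]; ring
    rw [h4] at h3
    nlinarith [Nat.zero_le ((2 * k + 1).choose k ^ 2)]

theorem Nat.choose_half_le_div_sqrt {n : ℕ} (hn : 0 < n) :
    (n.choose (n / 2) : ℝ) ≤ 2 ^ n / √(n : ℝ) := by
  have hn' : (0 : ℝ) < n := by exact_mod_cast hn
  have h : ((n.choose (n / 2) : ℝ)) ^ 2 * n ≤ 4 ^ n := by
    exact_mod_cast Nat.choose_half_sq_mul_le n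
  rw [le_div_iff₀ (Real.sqrt_pos.2 hn')]
  refine le_of_sq_le_sq ?_ (by positivity)
  rw [mul_pow, Real.sq_sqrt hn'.le, ← pow_mul, mul_comm n 2, pow_mul]
  norm_num
  exact h

theorem Nat.div_sqrt_le_choose_half {n : ℕ} (hn : 0 < n) (he : Even n) :
    2 ^ n / (2 * √(n : ℝ)) ≤ (n.choose (n / 2) : ℝ) := by
  have hn' : (0 : ℝ) < n := by exact_mod_cast hn
  obtain ⟨k, rfl⟩ := he
  rw [← two_mul, Nat.mul_div_cancel_left _ two_pos, ← Nat.centralBinom_eq_two_mul_choose]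
  have h : (16 : ℝ) ^ k ≤ (k.centralBinom : ℝ) ^ 2 * (4 * k) := by
    exact_mod_cast Nat.le_centralBinom_sq_mul (show 1 ≤ k by omega)
  rw [← two_mul] at hn'
  rw [div_le_iff₀ (by positivity)]
  refine le_of_sq_le_sq ?_ (by positivity)
  rw [mul_pow, mul_pow, Real.sq_sqrt hn'.le, pow_mul, ← pow_mul, mul_comm k 2, pow_mul]
  norm_num
  have hk : (0 : ℝ) ≤ k := by positivity
  nlinarith [sq_nonneg (k.centralBinom : ℝ), mul_nonneg (sq_nonneg (k.centralBinom : ℝ)) hk]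

end Binomial

/-! ### Injective descent through the upper levels -/

/-- `f` maps the sets of more than `m` elements injectively to subsets with one element less. -/
structure IsDownInjection (α : Type*) (m : ℕ) (f : Finset α → Finset α) : Prop where
  subset : ∀ S, m < S.card → f S ⊆ S
  card : ∀ S, m < S.card → (f S).card + 1 = S.card
  inj : ∀ S T, m < S.card → m < T.card → f S = f T → S = T

namespace IsDownInjection

variable {α : Type*} {m : ℕ} {f : Finset α → Finset α}

theorem iterate (hf : IsDownInjection α m f) (i : ℕ) :
    ∀ S : Finset α, m + i ≤ S.card → f^[i] S ⊆ S ∧ (f^[i] S).card + i = S.card := by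
  induction i with
  | zero => intro S _; simp
  | succ i ih =>
    intro S hS
    have h1 := hf.subset S (by omega)
    have h2 := hf.card S (by omega)
    have h3 := ih (f S) (by omega)
    rw [Function.iterate_succ_apply]
    exact ⟨h3.1.trans h1, by omega⟩

theorem iterate_inj (hf : IsDownInjection α m f) (i : ℕ) :
    ∀ S T : Finset α, m + i ≤ S.card → m + i ≤ T.card → f^[i] S = f^[i] T → S = T := by
  induction i with
  | zero => intro S T _ _ h; simpa using h
  | succ i ih =>
    intro S T hS hT h
    rw [Function.iterate_succ_apply, Function.iterate_succ_apply] at h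
    have h1 := hf.card S (by omega)
    have h2 := hf.card T (by omega)
    exact hf.inj S T (by omega) (by omega) (ih _ _ (by omega) (by omega) h)

/-- Injectivity of the i-th iterate gives S = f^[j - i] V, so sets descending to the same target
form a chain. -/
theorem subset_of_iterate_eq (hf : IsDownInjection α m f) {i j : ℕ} (hij : i ≤ j)
    {S V : Finset α} (hS : m + i ≤ S.card) (hV : m + j ≤ V.card) (h : f^[i] S = f^[j] V) :
    S ⊆ V := by
  have h1 := hf.iterate (j - i) V (by omega)
  have h2 : f^[i] S = f^[i] (f^[j - i] V) := by
    rw [← Function.iterate_add_apply, Nat.add_sub_cancel' hij, h]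
  rw [hf.iterate_inj i _ _ hS (by omega) h2]
  exact h1.1

end IsDownInjection

section DownInjection

variable {α : Type*} [DecidableEq α] [Fintype α]

theorem exists_injOn_erase_of_half_lt {r : ℕ} (hr : Fintype.card α < 2 * r) :
    ∃ f : Finset α → Finset α, Set.InjOn f {S | S.card = r} ∧
      ∀ S, S.card = r → f S ⊆ S ∧ (f S).card + 1 = S.card := by
  have hall : ∀ s : Finset {S : Finset α // S.card = r},
      s.card ≤ (s.biUnion fun S => Finset.shadow {S.1}).card := by
    intro s
    set 𝒜 := s.map (Function.Embedding.subtype _) with h𝒜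
    have h1 : (s.biUnion fun S => Finset.shadow {S.1}) = Finset.shadow 𝒜 := by
      ext T
      simp [Finset.mem_shadow_iff, h𝒜]
    have h2 : (𝒜 : Set (Finset α)).Sized r := by
      intro S hS
      simp only [h𝒜, Finset.coe_map, Set.mem_image] at hS
      obtain ⟨T, -, rfl⟩ := hS
      exact T.2
    -- Hall's condition: local LYM bounds |𝒜|·r by |∂𝒜|·(n − r + 1), and n − r + 1 ≤ r above the
    -- middle.
    have h3 := Finset.local_lubell_yamamoto_meshalkin_inequality_mul h2
    rw [h1, ← Finset.card_map (Function.Embedding.subtype _), ← h𝒜]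
    refine Nat.le_of_mul_le_mul_right (h3.trans (Nat.mul_le_mul_left _ ?_)) (show 0 < r by omega)
    omega
  obtain ⟨g, hg, hg'⟩ := (Finset.all_card_le_biUnion_card_iff_exists_injective _).1 hall
  refine ⟨fun S => if h : S.card = r then g ⟨S, h⟩ else S, ?_, ?_⟩
  · intro S hS T hT h
    simp only [Set.mem_ofPred_eq] at hS hT
    simp only [hS, hT, dif_pos] at h
    exact congrArg Subtype.val (hg h)
  · intro S hS
    have := hg' ⟨S, hS⟩
    simp only [hS, dif_pos]
    simp only [Finset.mem_shadow_iff, Finset.mem_singleton, exists_eq_left] at this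
    obtain ⟨a, ha, h⟩ := this
    rw [← h, ← hS]
    exact ⟨Finset.erase_subset _ _, Finset.card_erase_add_one ha⟩

theorem exists_isDownInjection {m : ℕ} (hm : Fintype.card α ≤ 2 * m) :
    ∃ f, IsDownInjection α m f := by
  have : ∀ r, ∃ f : Finset α → Finset α, m < r → Set.InjOn f {S | S.card = r} ∧
      ∀ S, S.card = r → f S ⊆ S ∧ (f S).card + 1 = S.card := by
    intro r
    by_cases h : m < r
    · obtain ⟨f, hf⟩ := exists_injOn_erase_of_half_lt (α := α) (r := r) (by omega)
      exact ⟨f, fun _ => hf⟩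
    · exact ⟨id, fun h' => absurd h' h⟩
  choose g hg using this
  refine ⟨fun S => g S.card S, fun S hS => ((hg _ hS).2 S rfl).1,
    fun S hS => ((hg _ hS).2 S rfl).2, fun S T hS hT h => ?_⟩
  have h1 := ((hg _ hS).2 S rfl).2
  have h2 := ((hg _ hT).2 T rfl).2
  have hST : T.card = S.card := by rw [← h1, ← h2, h]
  rw [hST] at h
  exact (hg _ hS).1 rfl hST h

end DownInjection

/-! ### Upper bound: the colouring by triples -/

section Coloring

variable {α : Type*} [DecidableEq α] [Fintype α]

/-- The colour of a large set is the first set of size `m` modulo `3` on its way down along `f`; a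
small set takes the colour of the triple of large sets contained in its complement. -/
def tripleColor (m : ℕ) (f : Finset α → Finset α) (S : Finset α) : Finset α :=
  if m ≤ S.card then f^[(S.card - m) % 3] S
  -- Large sets descend at most 2 steps and complements at least 2, so each complement contains
  -- every large set of its colour.
  else if m + 2 ≤ Sᶜ.card then f^[(Sᶜ.card - m - 2) % 3 + 2] Sᶜ
  else S

variable {m : ℕ} {f : Finset α → Finset α}

theorem tripleColor_cases (hf : IsDownInjection α m f) (S : Finset α) :
    (m ≤ S.card ∧ ∃ i ≤ 2, m + i ≤ S.card ∧ tripleColor m f S = f^[i] S ∧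
      (tripleColor m f S).card + i = S.card ∧ ((tripleColor m f S).card - m) % 3 = 0) ∨
    (S.card < m ∧ ∃ i, 2 ≤ i ∧ i ≤ 4 ∧ m + i ≤ Sᶜ.card ∧ tripleColor m f S = f^[i] Sᶜ ∧
      (tripleColor m f S).card + i = Sᶜ.card ∧ ((tripleColor m f S).card - m) % 3 = 0) ∨
    (S.card < m ∧ Sᶜ.card < m + 2 ∧ tripleColor m f S = S) := by
  unfold tripleColor
  split_ifs with h1 h2
  · left
    have := (hf.iterate ((S.card - m) % 3) S (by omega)).2
    exact ⟨h1, _, by omega, by omega, rfl, this, by omega⟩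
  · right; left
    have := (hf.iterate ((Sᶜ.card - m - 2) % 3 + 2) Sᶜ (by omega)).2
    exact ⟨by omega, _, by omega, by omega, by omega, rfl, this, by omega⟩
  · right; right
    exact ⟨by omega, by omega, rfl⟩

/-- A colour class has no cyclic sequence of four distinct, consecutively intersecting sets. -/
theorem not_cyclic_of_tripleColor_eq (hf : IsDownInjection α m f) {b : Finset α}
    {g : Fin 4 → Finset α} (hg : Function.Injective g) (hb : ∀ i, tripleColor m f (g i) = b)
    (hx : ∀ i, ∃ x, x ∈ g i ∧ x ∈ g (i + 1)) : False := by
  have hcases := fun i => tripleColor_cases hf (g i)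
  simp only [hb] at hcases
  by_cases hbm : m ≤ b.card
  · have hdisj : ∀ S T : Finset α, (∃ i ≤ 2, m + i ≤ S.card ∧ b = f^[i] S) →
        (∃ j, 2 ≤ j ∧ m + j ≤ Tᶜ.card ∧ b = f^[j] Tᶜ) → ∀ x ∈ S, x ∉ T := by
      rintro S T ⟨i, hi, hS, hbS⟩ ⟨j, hj, hT, hbT⟩ x hxS
      exact Finset.mem_compl.1
        (hf.subset_of_iterate_eq (hi.trans hj) hS hT (hbS.symm.trans hbT) hxS)
    -- Intersecting neighbours cannot be one large and one small, so the whole cycle lies on one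
    -- side, where three possible step counts give at most three sets.
    have hstep : ∀ i, m ≤ (g i).card ↔ m ≤ (g (i + 1)).card := by
      intro i
      obtain ⟨x, hx1, hx2⟩ := hx i
      rcases hcases i with ⟨h1, k, hk, hk1, hk2, -⟩ | ⟨h1, k, hk, -, hk1, hk2, -⟩ | ⟨h1, -, h2⟩ <;>
        rcases hcases (i + 1) with
          ⟨h1', k', hk', hk1', hk2', -⟩ | ⟨h1', k', hk', -, hk1', hk2', -⟩ | ⟨h1', -, h2'⟩
      · tauto
      · exact absurd hx2 (hdisj _ _ ⟨k, hk, hk1, hk2⟩ ⟨k', hk', hk1', hk2'⟩ x hx1)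
      · rw [← h2'] at h1'; omega
      · exact absurd hx1 (hdisj _ _ ⟨k', hk', hk1', hk2'⟩ ⟨k, hk, hk1, hk2⟩ x hx2)
      · omega
      · rw [← h2'] at h1'; omega
      · rw [← h2] at h1; omega
      · omega
      · omega
    have hall : (∀ i, m ≤ (g i).card) ∨ ∀ i, (g i).card < m := by
      have h0 := hstep 0
      have h1 := hstep 1
      have h2 := hstep 2
      simp only [Fin.isValue, zero_add, show (1 : Fin 4) + 1 = 2 from rfl,
        show (2 : Fin 4) + 1 = 3 from rfl] at h0 h1 h2
      by_cases h : m ≤ (g 0).card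
      · left
        intro i
        fin_cases i <;> simp <;> omega
      · right
        intro i
        fin_cases i <;> simp <;> omega
    rcases hall with hall | hall
    · have hk : ∀ i, ∃ k : Fin 3, b = f^[k] (g i) ∧ m + k ≤ (g i).card := by
        intro i
        rcases hcases i with ⟨-, k, hk, hk1, hk2, -⟩ | ⟨h, -⟩ | ⟨h, -⟩
        · exact ⟨⟨k, by omega⟩, hk2, hk1⟩
        · exact absurd (hall i) (by omega)
        · exact absurd (hall i) (by omega)
      choose k hk using hk
      obtain ⟨i, j, hij, h⟩ := Fintype.exists_ne_map_eq_of_card_lt k (by simp)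
      have h1 := hk i
      rw [h] at h1
      exact hij (hg (hf.iterate_inj _ _ _ h1.2 (hk j).2 (h1.1.symm.trans (hk j).1)))
    · have hk : ∀ i, ∃ k : Fin 3, b = f^[(k : ℕ) + 2] (g i)ᶜ ∧ m + (k + 2) ≤ (g i)ᶜ.card := by
        intro i
        rcases hcases i with ⟨h, -⟩ | ⟨-, k, hk, hk', hk1, hk2, -⟩ | ⟨h, -, h'⟩
        · exact absurd (hall i) (by omega)
        · refine ⟨⟨k - 2, by omega⟩, ?_⟩
          simp only [show k - 2 + 2 = k by omega]
          exact ⟨hk2, hk1⟩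
        · rw [← h'] at h; omega
      choose k hk using hk
      obtain ⟨i, j, hij, h⟩ := Fintype.exists_ne_map_eq_of_card_lt k (by simp)
      have h1 := hk i
      rw [h] at h1
      exact hij (hg (compl_injective
        (hf.iterate_inj _ _ _ h1.2 (hk j).2 (h1.1.symm.trans (hk j).1))))
  -- A colour below level m belongs to a leftover set alone.
  · have h : ∀ i, g i = b := by
      intro i
      rcases hcases i with ⟨-, k, -, h, -, h', -⟩ | ⟨-, k, -, -, h, -, h', -⟩ | ⟨-, -, h⟩
      · omega
      · omega
      · exact h.symm
    exact absurd (hg ((h 0).trans (h 1).symm)) (by decide)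

/-- The sets of size at least `m` whose size is `m + i` modulo `3`. -/
def levelsMod (α : Type*) [Fintype α] (m i : ℕ) : Finset (Finset α) :=
  Finset.univ.filter fun S => m ≤ S.card ∧ (S.card - m) % 3 = i

/-- Above level m, f injects residue 0 into residue 2, and residue 2 into residue 1; only level m
itself is unmatched. -/
theorem card_levelsMod_zero_le (hf : IsDownInjection α m f) :
    3 * (levelsMod α m 0).card ≤ 2 * (Fintype.card α).choose m +
      (Finset.univ.filter fun S : Finset α => m ≤ S.card).card := by
  have hlev : (Finset.univ.filter fun S : Finset α => S.card = m).card =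
      (Fintype.card α).choose m := by
    rw [← Finset.card_univ, ← Finset.card_powersetCard]
    congr 1
    ext S
    simp [Finset.mem_powersetCard]
  have h02 : (levelsMod α m 0).card ≤ (Fintype.card α).choose m + (levelsMod α m 2).card := by
    rw [← hlev, ← Finset.card_filter_add_card_filter_not (fun S : Finset α => S.card = m)]
    refine Nat.add_le_add (Finset.card_le_card fun S => by simp +contextual) ?_
    refine Finset.card_le_card_of_injOn f ?_ ?_
    · intro S hS
      simp only [levelsMod, Finset.coe_filter, Finset.mem_filter, Finset.mem_univ, true_and,
        Set.mem_ofPred_eq] at hS ⊢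
      have := hf.card S (by omega)
      omega
    · intro S hS T hT h
      simp only [levelsMod, Finset.coe_filter, Finset.mem_filter, Finset.mem_univ, true_and,
        Set.mem_ofPred_eq] at hS hT
      exact hf.inj S T (by omega) (by omega) h
  have h21 : (levelsMod α m 2).card ≤ (levelsMod α m 1).card := by
    refine Finset.card_le_card_of_injOn f ?_ ?_
    · intro S hS
      simp only [levelsMod, Finset.coe_filter, Finset.mem_univ, true_and,
        Set.mem_ofPred_eq] at hS ⊢
      have := hf.card S (by omega)
      omega
    · intro S hS T hT h
      simp only [levelsMod, Finset.coe_filter, Finset.mem_univ, true_and,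
        Set.mem_ofPred_eq] at hS hT
      exact hf.inj S T (by omega) (by omega) h
  have hsum : (levelsMod α m 0).card + (levelsMod α m 1).card + (levelsMod α m 2).card ≤
      (Finset.univ.filter fun S : Finset α => m ≤ S.card).card := by
    rw [← Finset.card_union_of_disjoint, ← Finset.card_union_of_disjoint]
    · refine Finset.card_le_card fun S => ?_
      simp only [levelsMod, Finset.mem_union, Finset.mem_filter, Finset.mem_univ, true_and]
      omega
    · rw [Finset.disjoint_left]
      intro S
      simp only [levelsMod, Finset.mem_union, Finset.mem_filter, Finset.mem_univ, true_and]
      omega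
    · rw [Finset.disjoint_left]
      intro S
      simp only [levelsMod, Finset.mem_filter, Finset.mem_univ, true_and]
      omega
  omega

/-- The upper half and its image under complementation meet only in sets of size m. -/
theorem two_mul_card_half_le (hm : Fintype.card α ≤ 2 * m) :
    2 * (Finset.univ.filter fun S : Finset α => m ≤ S.card).card ≤
      2 ^ Fintype.card α + (Fintype.card α).choose m := by
  set U := Finset.univ.filter fun S : Finset α => m ≤ S.card with hU
  have h1 : (U.image compl).card = U.card :=
    Finset.card_image_of_injective _ compl_injective
  have h2 := Finset.card_union_add_card_inter U (U.image compl)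
  have h3 : (U ∪ U.image compl).card ≤ 2 ^ Fintype.card α := by
    rw [← Fintype.card_finset]
    exact Finset.card_le_univ _
  have h4 : (U ∩ U.image compl).card ≤ (Fintype.card α).choose m := by
    rw [← Finset.card_univ, ← Finset.card_powersetCard]
    refine Finset.card_le_card fun S hS => ?_
    simp only [hU, Finset.mem_inter, Finset.mem_image, Finset.mem_filter, Finset.mem_univ,
      true_and] at hS
    obtain ⟨hS, T, hT, rfl⟩ := hS
    have := Finset.card_add_card_compl T
    simp only [Finset.mem_powersetCard, Finset.subset_univ, true_and]
    omega
  omega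

/-- Leftover sets lie on levels m − 1 and m − 2. The constant is 17 = 5 + 12: 5 from the residue
class, 6 from each leftover level. -/
theorem card_image_tripleColor_le (hm : m = (Fintype.card α + 1) / 2)
    (hf : IsDownInjection α m f) :
    6 * (Finset.univ.image (tripleColor m f)).card ≤
      2 ^ Fintype.card α + 17 * (Fintype.card α).choose (Fintype.card α / 2) := by
  have hsub : Finset.univ.image (tripleColor m f) ⊆
      (levelsMod α m 0 ∪ Finset.univ.powersetCard (m - 1)) ∪
        Finset.univ.powersetCard (m - 2) := by
    intro b hb
    obtain ⟨S, -, rfl⟩ := Finset.mem_image.1 hb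
    simp only [levelsMod, Finset.mem_union, Finset.mem_filter, Finset.mem_univ, true_and,
      Finset.mem_powersetCard, Finset.subset_univ]
    have := Finset.card_add_card_compl S
    rcases tripleColor_cases hf S with ⟨-, i, h⟩ | ⟨-, i, h⟩ | ⟨h1, h2, h3⟩
    · omega
    · omega
    · rw [h3]; omega
  have h1 := Finset.card_le_card hsub
  have h2 := Finset.card_union_le (levelsMod α m 0 ∪ Finset.univ.powersetCard (m - 1))
    (Finset.univ.powersetCard (m - 2))
  have h3 := Finset.card_union_le (levelsMod α m 0) (Finset.univ.powersetCard (m - 1))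
  rw [Finset.card_powersetCard, Finset.card_univ] at h2 h3
  have h4 := Nat.choose_le_middle (m - 1) (Fintype.card α)
  have h5 := Nat.choose_le_middle (m - 2) (Fintype.card α)
  have h6 := Nat.choose_le_middle m (Fintype.card α)
  have h7 := card_levelsMod_zero_le hf
  have h8 := two_mul_card_half_le (α := α) (m := m) (by omega)
  omega

end Coloring

/-! ### Bounds on the number of colours -/

theorem exists_isBergeFreeColoring (n : ℕ) :
    ∃ t, 6 * t ≤ 2 ^ n + 17 * n.choose (n / 2) ∧ ∃ c : Finset (Fin n) → Fin t,
      IsBergeFreeColoring (SimpleGraph.cycleGraph 4) n t c := by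
  obtain ⟨f, hf⟩ := exists_isDownInjection (α := Fin n) (m := (n + 1) / 2)
    (by rw [Fintype.card_fin]; omega)
  have hcard := card_image_tripleColor_le (by rw [Fintype.card_fin]) hf
  rw [Fintype.card_fin] at hcard
  set K := Finset.univ.image (tripleColor ((n + 1) / 2) f) with hK
  have hmem : ∀ S, tripleColor ((n + 1) / 2) f S ∈ K := fun S =>
    Finset.mem_image_of_mem _ (Finset.mem_univ S)
  refine ⟨K.card, hcard, fun S => K.equivFin ⟨_, hmem S⟩, ?_⟩
  intro i F hF hB
  obtain ⟨g, hg, hgF, hx⟩ := hB.exists_cyclic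
  refine not_cyclic_of_tripleColor_eq hf (b := (K.equivFin.symm i).1) hg (fun j => ?_) hx
  have : K.equivFin ⟨_, hmem (g j)⟩ = i := hF (hgF j)
  rw [← this, Equiv.symm_apply_apply]

theorem bergeColorNumber_cycleFour_le (n : ℕ) :
    6 * bergeColorNumber n (SimpleGraph.cycleGraph 4) ≤ 2 ^ n + 17 * n.choose (n / 2) := by
  obtain ⟨t, ht, hc⟩ := exists_isBergeFreeColoring n
  exact (Nat.mul_le_mul_left 6 (Nat.sInf_le hc)).trans ht

theorem le_bergeColorNumber_cycleFour {n : ℕ} (hn : 26 ≤ n) :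
    3 * 2 ^ n + (Finset.univ.filter fun A : Finset (Fin n) => 2 * A.card = n).card ≤
      18 * bergeColorNumber n (SimpleGraph.cycleGraph 4) := by
  obtain ⟨t, -, ht⟩ := exists_isBergeFreeColoring n
  obtain ⟨c, hc⟩ : ∃ c, IsBergeFreeColoring (SimpleGraph.cycleGraph 4) n
      (bergeColorNumber n (SimpleGraph.cycleGraph 4)) c :=
    Nat.sInf_mem (s := {t | ∃ c, IsBergeFreeColoring (SimpleGraph.cycleGraph 4) n t c}) ⟨t, ht⟩
  have h1 := two_mul_sum_halfWeight (α := Fin n)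
  rw [Fintype.card_fin, ← Finset.sum_fiberwise Finset.univ c halfWeight] at h1
  have h2 : ∀ i ∈ (Finset.univ : Finset (Fin (bergeColorNumber n (SimpleGraph.cycleGraph 4)))),
      ∑ A with c A = i, halfWeight A ≤ 9 := fun i _ =>
    BergeFree.sum_halfWeight_le (by simpa using hc i) (by rwa [Fintype.card_fin])
  have h3 := Finset.sum_le_card_nsmul _ _ _ h2
  rw [Finset.card_univ, Fintype.card_fin, smul_eq_mul] at h3
  omega

theorem two_pow_div_three_le {n : ℕ} (hn : 26 ≤ n) :
    (2 : ℝ) ^ (n - 1) / 3 ≤ (bergeColorNumber n (SimpleGraph.cycleGraph 4) : ℝ) := by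
  have h := le_bergeColorNumber_cycleFour hn
  have h1 : (3 * 2 ^ n : ℝ) ≤ 18 * (bergeColorNumber n (SimpleGraph.cycleGraph 4) : ℝ) := by
    exact_mod_cast (Nat.le_add_right _ _).trans h
  have h2 : (2 : ℝ) ^ n = 2 * 2 ^ (n - 1) := by
    rw [← pow_succ', Nat.sub_add_cancel (by omega)]
  linarith

theorem bergeColorNumber_le_mul {n : ℕ} (hn : 0 < n) :
    (bergeColorNumber n (SimpleGraph.cycleGraph 4) : ℝ) ≤
      (2 : ℝ) ^ (n - 1) / 3 * (1 + 17 / √(n : ℝ)) := by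
  have h : (6 * bergeColorNumber n (SimpleGraph.cycleGraph 4) : ℝ) ≤
      2 ^ n + 17 * (n.choose (n / 2) : ℝ) := by
    exact_mod_cast bergeColorNumber_cycleFour_le n
  have h1 := Nat.choose_half_le_div_sqrt hn
  have h2 : (2 : ℝ) ^ n = 2 * 2 ^ (n - 1) := by
    rw [← pow_succ', Nat.sub_add_cancel hn]
  have h3 : (2 : ℝ) ^ (n - 1) / 3 * (1 + 17 / √(n : ℝ)) =
      (2 ^ n + 17 * (2 ^ n / √(n : ℝ))) / 6 := by rw [h2]; ring
  rw [h3]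
  linarith

theorem mul_le_bergeColorNumber_of_even {n : ℕ} (hn : 26 ≤ n) (he : Even n) :
    (2 : ℝ) ^ (n - 1) / 3 * (1 + (1 / 6) / √(n : ℝ)) ≤
      (bergeColorNumber n (SimpleGraph.cycleGraph 4) : ℝ) := by
  have hmid : (Finset.univ.filter fun A : Finset (Fin n) => 2 * A.card = n).card =
      n.choose (n / 2) := by
    have : (Finset.univ.filter fun A : Finset (Fin n) => 2 * A.card = n) =
        Finset.univ.powersetCard (n / 2) := by
      ext A
      have := he.two_dvd
      simp only [Finset.mem_filter, Finset.mem_univ, true_and, Finset.mem_powersetCard,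
        Finset.subset_univ]
      omega
    rw [this, Finset.card_powersetCard, Finset.card_univ, Fintype.card_fin]
  have h := le_bergeColorNumber_cycleFour hn
  rw [hmid] at h
  have h' : (3 * 2 ^ n + n.choose (n / 2) : ℝ) ≤
      18 * (bergeColorNumber n (SimpleGraph.cycleGraph 4) : ℝ) := by exact_mod_cast h
  have h1 := Nat.div_sqrt_le_choose_half (by omega) he
  have h2 : (2 : ℝ) ^ n = 2 * 2 ^ (n - 1) := by
    rw [← pow_succ', Nat.sub_add_cancel (by omega)]
  have h3 : (2 : ℝ) ^ (n - 1) / 3 * (1 + (1 / 6) / √(n : ℝ)) =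
      (3 * 2 ^ n + 2 ^ n / (2 * √(n : ℝ))) / 18 := by rw [h2]; ring
  rw [h3]
  linarith

theorem theorem2 :
    (∃ c C : ℝ, 0 < c ∧ 0 < C ∧ ∀ n : ℕ, 26 ≤ n → Even n →
      (2 : ℝ) ^ (n - 1) / 3 * (1 + c / Real.sqrt (n : ℝ))
          ≤ (bergeColorNumber n (SimpleGraph.cycleGraph 4) : ℝ) ∧
      (bergeColorNumber n (SimpleGraph.cycleGraph 4) : ℝ)
          ≤ (2 : ℝ) ^ (n - 1) / 3 * (1 + C / Real.sqrt (n : ℝ))) ∧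
    (∃ C : ℝ, 0 < C ∧ ∀ n : ℕ, 27 ≤ n →
      (2 : ℝ) ^ (n - 1) / 3 ≤ (bergeColorNumber n (SimpleGraph.cycleGraph 4) : ℝ) ∧
      (bergeColorNumber n (SimpleGraph.cycleGraph 4) : ℝ)
          ≤ (2 : ℝ) ^ (n - 1) / 3 * (1 + C / Real.sqrt (n : ℝ))) :=
  ⟨⟨1 / 6, 17, by norm_num, by norm_num, fun _ hn he =>
    ⟨mul_le_bergeColorNumber_of_even hn he, bergeColorNumber_le_mul (by omega)⟩⟩,
    17, by norm_num, fun _ hn => ⟨two_pow_div_three_le (by omega),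
      bergeColorNumber_le_mul (by omega)⟩⟩
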